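/- Let $\Sigma$ be an alphabet (a set of letters), let $n\ge 2$, and let $\Xi=\{x_1,\dots,x_n\}$ be a set of $n$ unknowns. A (coefficient-free) word equation $E: u=v$ on $n$ unknowns is a pair of words $u,v\in\Xi^*$; it is trivial if $u$ and $v$ are the same word, and $|E|_x$ denotes the number of occurrences of the unknown $x$ in $uv$. A solution of $E$ is a morphism $h:\Xi^*\to\Sigma^*$ with $h(u)=h(v)$. The rank of a morphism $h:\Xi^*\to\Sigma^*$ is the smallest $r$ for which there is a set $A\subseteq\Sigma^*$ of $r$ words with $h(x)\in A^*$ for every $x\in\Xi$, and the length type of $h$ is the vector $(|h(x_1)|,\dots,|h(x_n)|)\in\mathbb{N}_0^n\subset\mathbb{Q}^n$. Let $\mathrm{Sol}_{n-1}(E_1,\dots,E_i)$ denote the set of common solutions of $E_1,\dots,E_i$ of rank $n-1$. Let $m\ge 1$ and let $E_1,\dots,E_m$ be nontrivial equations on $n$ unknowns such that $$\mathrm{Sol}_{n-1}(E_1)\supsetneq \mathrm{Sol}_{n-1}(E_1,E_2)\supsetneq\dots\supsetneq \mathrm{Sol}_{n-1}(E_1,\dots,E_m)\neq\varnothing .$$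 Then the following hold. (1) If $m\ge 2$ and the set of length types of the elements of $\mathrm{Sol}_{n-1}(E_1,E_2)$ is covered by a union of $N$ $(n-1)$-dimensional subspaces of $\mathbb{Q}^n$, then $m\le N+1$. (2) There are two distinct unknowns $x,y\in\Xi$ such that $m\le(|E_1|_x+|E_1|_y)^2+1$. -/

import Mathlib

/-- A coefficient-free word equation `lhs = rhs` on the unknowns `x_0, …, x_{n-1}`,
indexed by `Fin n`: a pair of words over the unknowns. -/
structure WordEquation (n : ℕ) where
  /-- The left-hand side. -/
  lhs : FreeMonoid (Fin n)
  /-- The right-hand side. -/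
  rhs : FreeMonoid (Fin n)

namespace WordEquation

variable {n : ℕ}

/-- An equation is trivial if its two sides are the same word. -/
def IsTrivial (E : WordEquation n) : Prop := E.lhs = E.rhs

/-- `|E|_x`: the number of occurrences of the unknown `x` in the word `lhs * rhs`. -/
def occ (E : WordEquation n) (x : Fin n) : ℕ :=
  (FreeMonoid.toList (E.lhs * E.rhs)).count x

/-- A morphism `h` into the words over the alphabet `α` is a solution of `E` if it maps
the two sides of `E` to the same word. -/
def IsSolution {α : Type*} (E : WordEquation n) (h : FreeMonoid (Fin n) →* FreeMonoid α) :
    Prop :=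
  h E.lhs = h E.rhs

end WordEquation

/-- The combinatorial rank of a morphism `h`: the least `r` such that, for some set `A` of `r`
words, all the words `h(x)` (with `x` an unknown) lie in `A^*`. -/
noncomputable def morphismRank {n : ℕ} {α : Type*}
    (h : FreeMonoid (Fin n) →* FreeMonoid α) : ℕ :=
  sInf {r : ℕ | ∃ A : Finset (FreeMonoid α), A.card = r ∧
    ∀ x : Fin n, h (FreeMonoid.of x) ∈ Submonoid.closure (A : Set (FreeMonoid α))}

/-- The length type `(|h(x_0)|, …, |h(x_{n-1})|)` of a morphism `h`. -/
def lengthType {n : ℕ} {α : Type*} (h : FreeMonoid (Fin n) →* FreeMonoid α) : Fin n → ℕ :=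
  fun x => (h (FreeMonoid.of x)).length

/-- The set of common solutions of rank `r`, with values in the words over the alphabet `α`,
of the system `S` of word equations. -/
def rankSol {n : ℕ} (α : Type*) (r : ℕ) (S : Set (WordEquation n)) :
    Set (FreeMonoid (Fin n) →* FreeMonoid α) :=
  {h | morphismRank h = r ∧ ∀ E ∈ S, E.IsSolution h}

/-! Fix a length type `L` and give each unknown `x` the weight `X ^ L x`. By Fox calculus, an
equation `E` then becomes one linear equation over `ℚ[X]`: its coefficient vector `E.row` is the
difference of the Fox derivatives of the two sides. A morphism of length type `L` solves `E` exactly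
when the position polynomials of each letter in its values are orthogonal to this row
(`WordEquation.isSolution_iff`). Hence, if the rows of `E` and `E'` are proportional at `L` and that
of `E` is nonzero, every solution of `E` of length type `L` solves `E'`
(`WordEquation.IsSolution.of_minors_eq`).

Conversely, a solution `h` of rank `n - 1` of a nontrivial equation factors as `θ ∘ f` through a
free monoid on `n - 1` letters, where `f` already satisfies every equation that `h` does
(`exists_factorization`). The rows of these equations annihilate a space of dimension `n - 1`, so
they are all proportional. This happens not only at the length type of `h` but, up to scaling `L`,
on the whole `(n - 1)`-dimensional space `U` of length types obtained from `f`. Rank `n - 1`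
morphisms through `f` have length types avoiding any finite set of proper subspaces of `U`, so a
covering hyperplane must equal `U` (`exists_space_of_rank`).

For (1), each strict inclusion after the first two equations has a separating solution, whose `U` is
one of the covering hyperplanes. A hyperplane used twice would make the earlier separating solution
solve the equation it violates (`chain_length_le`).

For (2), a separating solution of the first two equations makes some 2×2 minor of their rows
nonzero. That minor is a difference of two sums of powers of `X` whose exponents are linear forms in
`L`, and each sum splits into `|E|_x + |E|_y` increasing chains. If it vanishes at `L`, then after
cancelling common forms the least exponents on the two sides agree, and these are attained at first
surviving elements of chains. So one hyperplane per pair of chains suffices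
(`WordEquation.exists_hyperplanes`). -/

/-! ### Crossed homomorphisms on free monoids -/

/-- The crossed homomorphism on words with values in `R`, determined by the weights `c` and the
values `p` of the letters: `D (u * v) = D u + c(u) * D v`. -/
def crossedHom {β R : Type*} [CommRing R] (c p : β → R) (w : FreeMonoid β) : R :=
  (FreeMonoid.toList w).foldr (fun a r => p a + c a * r) 0

section crossedHom

variable {β R : Type*} [CommRing R] (c p : β → R)

@[simp] lemma crossedHom_one : crossedHom c p 1 = 0 := rfl

@[simp] lemma crossedHom_of_mul (a : β) (w : FreeMonoid β) :
    crossedHom c p (FreeMonoid.of a * w) = p a + c a * crossedHom c p w := rfl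

@[simp] lemma crossedHom_of (a : β) : crossedHom c p (FreeMonoid.of a) = p a := by
  simpa using crossedHom_of_mul c p a 1

lemma crossedHom_mul (u v : FreeMonoid β) :
    crossedHom c p (u * v) = crossedHom c p u + FreeMonoid.lift c u * crossedHom c p v := by
  induction u using FreeMonoid.inductionOn' with
  | one => simp
  | of_mul a u ih => simp [mul_assoc, ih]; ring

lemma crossedHom_map {γ : Type*} (φ : FreeMonoid γ →* FreeMonoid β) (w : FreeMonoid γ) :
    crossedHom c p (φ w) = crossedHom (fun x => FreeMonoid.lift c (φ (FreeMonoid.of x)))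
      (fun x => crossedHom c p (φ (FreeMonoid.of x))) w := by
  induction w using FreeMonoid.inductionOn' with
  | one => simp
  | of_mul a u ih => simp [crossedHom_mul, ih]

lemma map_crossedHom {S : Type*} [CommRing S] (φ : R →+* S) (w : FreeMonoid β) :
    φ (crossedHom c p w) = crossedHom (fun x => φ (c x)) (fun x => φ (p x)) w := by
  induction w using FreeMonoid.inductionOn' with
  | one => simp
  | of_mul a u ih => simp [ih]

lemma crossedHom_add (p q : β → R) (w : FreeMonoid β) :
    crossedHom c (p + q) w = crossedHom c p w + crossedHom c q w := by
  induction w using FreeMonoid.inductionOn' with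
  | one => simp
  | of_mul a u ih => simp [ih]; ring

lemma crossedHom_smul (r : R) (w : FreeMonoid β) :
    crossedHom c (r • p) w = r * crossedHom c p w := by
  induction w using FreeMonoid.inductionOn' with
  | one => simp
  | of_mul a u ih => simp [ih]; ring

/-- The fundamental formula of Fox calculus: the values at `Pi.single x 1` are the Fox derivatives,
and they determine every other crossed homomorphism with the same weights. -/
lemma crossedHom_eq_sum [Fintype β] [DecidableEq β] (w : FreeMonoid β) :
    crossedHom c p w = ∑ x, crossedHom c (Pi.single x 1) w * p x := by
  induction w using FreeMonoid.inductionOn' with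
  | one => simp
  | of_mul a u ih =>
    simp [ih, add_mul, Finset.sum_add_distrib, mul_assoc, Finset.mul_sum, Pi.single_apply]

end crossedHom

/-! ### Recovering a word from its Fox derivatives -/

open Polynomial in
lemma coeff_zero_crossedHom_single_nonneg {β : Type*} [DecidableEq β] (L : β → ℕ) (x : β)
    (w : FreeMonoid β) :
    0 ≤ (crossedHom (fun a => (X : ℚ[X]) ^ L a) (Pi.single x 1) w).coeff 0 := by
  induction w using FreeMonoid.inductionOn' with
  | one => simp
  | of_mul a u ih =>
    rw [crossedHom_of_mul, coeff_add, mul_coeff_zero]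
    refine add_nonneg ?_ (mul_nonneg ?_ ih)
    · by_cases h : a = x
      · subst h; simp
      · simp [h]
    · rw [coeff_X_pow]; split_ifs <;> norm_num

open Polynomial in
/-- A word is determined by its Fox derivatives, evaluated at the powers of one variable given
by a length type with at most one zero component. -/
lemma eq_of_crossedHom_single_eq {β : Type*} [DecidableEq β] (L : β → ℕ)
    (hL : ∀ x y, x ≠ y → L x ≠ 0 ∨ L y ≠ 0) (u v : FreeMonoid β)
    (h : ∀ x, crossedHom (fun a => (X : ℚ[X]) ^ L a) (Pi.single x 1) u =
      crossedHom (fun a => (X : ℚ[X]) ^ L a) (Pi.single x 1) v) : u = v := by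
  have pos : ∀ (b : β) (w : FreeMonoid β), 0 < (crossedHom (fun a => (X : ℚ[X]) ^ L a)
      (Pi.single b 1) (FreeMonoid.of b * w)).coeff 0 := by
    intro b w
    rw [crossedHom_of_mul, coeff_add, mul_coeff_zero]
    have h1 := coeff_zero_crossedHom_single_nonneg L b w
    have h2 : 0 ≤ ((X : ℚ[X]) ^ L b).coeff 0 := by
      rw [coeff_X_pow]; split_ifs <;> norm_num
    have h3 := mul_nonneg h2 h1
    simp only [Pi.single_eq_same, coeff_one_zero]
    linarith
  have zero : ∀ (a b : β) (w : FreeMonoid β), a ≠ b → L a ≠ 0 →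
      (crossedHom (fun a => (X : ℚ[X]) ^ L a)
      (Pi.single b 1) (FreeMonoid.of a * w)).coeff 0 = 0 := by
    intro a b w hab ha
    rw [crossedHom_of_mul, coeff_add, mul_coeff_zero, coeff_X_pow, if_neg (Ne.symm ha)]
    simp [hab]
  -- Constant coefficients detect the first letter: the derivative in the first letter has a
  -- positive one, while the derivative in another letter has none once the first letter has
  -- positive weight. For two distinct first letters, at least one has positive weight.
  induction u using FreeMonoid.inductionOn' generalizing v with
  | one =>
    induction v using FreeMonoid.inductionOn' with
    | one => rfl
    | of_mul b v _ =>
      have h1 := pos b v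
      rw [← h b] at h1
      simp at h1
  | of_mul a u ih =>
    induction v using FreeMonoid.inductionOn' with
    | one =>
      have h1 := pos a u
      rw [h a] at h1
      simp at h1
    | of_mul b v _ =>
      by_cases hab : a = b
      · subst hab
        rw [ih v]
        intro x
        have h1 := h x
        rw [crossedHom_of_mul, crossedHom_of_mul] at h1
        exact mul_left_cancel₀ (pow_ne_zero _ X_ne_zero) (add_left_cancel h1)
      · rcases hL a b hab with ha | hb
        · have h1 := pos b v
          rw [← h b, zero a b u hab ha] at h1
          exact absurd h1 (lt_irrefl _)
        · have h1 := pos a u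
          rw [h a, zero b a v (Ne.symm hab) hb] at h1
          exact absurd h1 (lt_irrefl _)

/-! ### The linear equation attached to a word equation -/

namespace WordEquation

variable {n : ℕ} {R : Type*} [CommRing R]

/-- The row of coefficients of the linear equation attached to a word equation `E` and to
weights `c`: the difference of the Fox derivatives of the two sides. -/
def row (E : WordEquation n) (c : Fin n → R) (x : Fin n) : R :=
  crossedHom c (Pi.single x 1) E.lhs - crossedHom c (Pi.single x 1) E.rhs

lemma sum_row_mul (E : WordEquation n) (c p : Fin n → R) :
    ∑ x, E.row c x * p x = crossedHom c p E.lhs - crossedHom c p E.rhs := by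
  rw [crossedHom_eq_sum c p E.lhs, crossedHom_eq_sum c p E.rhs, ← Finset.sum_sub_distrib]
  simp [row, sub_mul]

lemma map_row {S : Type*} [CommRing S] (φ : R →+* S) (E : WordEquation n) (c : Fin n → R)
    (x : Fin n) : φ (E.row c x) = E.row (fun y => φ (c y)) x := by
  have : (fun y => φ ((Pi.single x 1 : Fin n → R) y)) = (Pi.single x 1 : Fin n → S) := by
    ext y; by_cases h : y = x
    · subst h; simp
    · simp [h]
  simp [row, map_crossedHom, this]

open Polynomial

lemma exists_row_ne_zero (E : WordEquation n) (hE : ¬ E.IsTrivial) (L : Fin n → ℕ)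
    (hL : ∀ x y, x ≠ y → L x ≠ 0 ∨ L y ≠ 0) :
    ∃ x, E.row (fun a => (X : ℚ[X]) ^ L a) x ≠ 0 := by
  by_contra! h
  exact hE (eq_of_crossedHom_single_eq L hL _ _ fun x => sub_eq_zero.1 (h x))

variable {α : Type*}

lemma lift_const_pow (k : ℕ) (w : FreeMonoid α) :
    FreeMonoid.lift (fun _ => (X : ℚ[X]) ^ k) w = X ^ (k * w.length) := by
  induction w using FreeMonoid.inductionOn' with
  | one => simp
  | of_mul a u ih => simp [ih, mul_add, pow_add]

/-- The equation `E` holds for `h` iff certain polynomial vectors read off from `h` are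
orthogonal to the row of `E` at the length type of `h`, scaled by `k`. -/
lemma isSolution_iff (E : WordEquation n) (h : FreeMonoid (Fin n) →* FreeMonoid α) {k : ℕ}
    (hk : k ≠ 0) [DecidableEq α] : E.IsSolution h ↔ ∀ a : α,
      ∑ x, E.row (fun x => (X : ℚ[X]) ^ (k * lengthType h x)) x *
        crossedHom (fun _ => (X : ℚ[X]) ^ k) (Pi.single a 1) (h (FreeMonoid.of x)) = 0 := by
  have key : ∀ a : α, (∑ x, E.row (fun x => (X : ℚ[X]) ^ (k * lengthType h x)) x *
      crossedHom (fun _ => (X : ℚ[X]) ^ k) (Pi.single a 1) (h (FreeMonoid.of x))) =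
      crossedHom (fun _ => (X : ℚ[X]) ^ k) (Pi.single a 1) (h E.lhs) -
      crossedHom (fun _ => (X : ℚ[X]) ^ k) (Pi.single a 1) (h E.rhs) := by
    intro a
    rw [sum_row_mul, crossedHom_map, crossedHom_map]
    simp [lift_const_pow, lengthType]
  simp only [key, sub_eq_zero]
  constructor
  · intro hs a
    rw [show h E.lhs = h E.rhs from hs]
  · intro hs
    exact eq_of_crossedHom_single_eq (fun _ => k) (fun _ _ _ => Or.inl hk) _ _ hs

/-- If the rows of `E` and `E'` are proportional at a multiple of the length type of `h`, then
`h` solves `E'` as soon as it solves `E`. -/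
lemma IsSolution.of_minors_eq {E E' : WordEquation n} (hE : ¬ E.IsTrivial)
    {h : FreeMonoid (Fin n) →* FreeMonoid α} (hs : E.IsSolution h) {k : ℕ} (hk : k ≠ 0)
    (hL : ∀ x y, x ≠ y → lengthType h x ≠ 0 ∨ lengthType h y ≠ 0)
    (hminor : ∀ x y,
      E.row (fun x => (X : ℚ[X]) ^ (k * lengthType h x)) x *
        E'.row (fun x => (X : ℚ[X]) ^ (k * lengthType h x)) y =
      E.row (fun x => (X : ℚ[X]) ^ (k * lengthType h x)) y *
        E'.row (fun x => (X : ℚ[X]) ^ (k * lengthType h x)) x) : E'.IsSolution h := by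
  classical
  rw [isSolution_iff _ _ hk] at hs ⊢
  intro a
  obtain ⟨x, hx⟩ := E.exists_row_ne_zero hE (fun x => k * lengthType h x) (by simpa [hk] using hL)
  refine (mul_eq_zero.1 ?_).resolve_left hx
  rw [Finset.mul_sum]
  have := congrArg (E'.row (fun x => (X : ℚ[X]) ^ (k * lengthType h x)) x * ·) (hs a)
  simp only [Finset.mul_sum, mul_zero] at this
  rw [← this]
  refine Finset.sum_congr rfl fun y _ => ?_
  rw [← mul_assoc, hminor x y]
  ring

end WordEquation

/-! ### Factorization through a prefix code -/

section Factorization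

variable {ι : Type} {α : Type*}

lemma lift_ne_zero {β R : Type*} [CommRing R] [IsDomain R] {c : β → R} (hc : ∀ y, c y ≠ 0)
    (w : FreeMonoid β) : FreeMonoid.lift c w ≠ 0 := by
  induction w using FreeMonoid.inductionOn' with
  | one => simp
  | of_mul a u ih => simpa using ⟨hc a, ih⟩

/-- A family of nonempty, pairwise prefix-incomparable words is a code. -/
lemma injective_of_prefix_free {Y : Type*} (θ : FreeMonoid Y →* FreeMonoid α)
    (hne : ∀ y, θ (FreeMonoid.of y) ≠ 1)
    (hpre : ∀ y z w, θ (FreeMonoid.of z) = θ (FreeMonoid.of y) * w → y = z) :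
    Function.Injective θ := by
  have aux : ∀ (a : Y) (u : FreeMonoid Y), θ (FreeMonoid.of a * u) ≠ 1 := by
    intro a u hu
    rw [map_mul] at hu
    exact hne a (List.append_eq_nil_iff.1 hu).1
  intro u
  induction u using FreeMonoid.inductionOn' with
  | one =>
    intro v hv
    induction v using FreeMonoid.inductionOn' with
    | one => rfl
    | of_mul b v _ => exact absurd (hv.symm.trans (map_one θ)) (aux b v)
  | of_mul a u ih =>
    intro v hv
    induction v using FreeMonoid.inductionOn' with
    | one => exact absurd (hv.trans (map_one θ)) (aux a u)
    | of_mul b v _ =>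
      rw [map_mul, map_mul] at hv
      have hab : a = b := by
        rcases List.append_eq_append_iff.1 hv with ⟨w, hw, _⟩ | ⟨w, hw, _⟩
        · exact hpre a b w hw
        · exact (hpre b a w hw).symm
      subst hab
      rw [ih (mul_left_cancel hv)]

/-- Every morphism `h` factors as `θ ∘ f`, where `f` satisfies every equation that `h` satisfies
and crossed homomorphisms on the intermediate free monoid are determined by their restriction
along `f`. -/
theorem exists_factorization [Fintype ι] (h : FreeMonoid ι →* FreeMonoid α) :
    ∃ (Y : Type) (_ : Fintype Y) (f : FreeMonoid ι →* FreeMonoid Y)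
      (θ : FreeMonoid Y →* FreeMonoid α), θ.comp f = h ∧ (∀ u v, h u = h v → f u = f v) ∧
      ∀ (R : Type) [CommRing R] [IsDomain R] (c p : Y → R), (∀ y, c y ≠ 0) →
        (∀ x, crossedHom c p (f (FreeMonoid.of x)) = 0) → p = 0 := by
  classical
  induction hN : ∑ x, (h (FreeMonoid.of x)).length using Nat.strong_induction_on generalizing h with
  | _ N ih =>
  -- Nielsen reduction: while a nonempty value `h x` is a prefix of another value `h y`, strip it
  -- off. The total length drops, so this terminates.
  by_cases hred : ∃ x y w, x ≠ y ∧ h (FreeMonoid.of x) ≠ 1 ∧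
      h (FreeMonoid.of y) = h (FreeMonoid.of x) * w
  · obtain ⟨x, y, w, hxy, hx, hy⟩ := hred
    let h' : FreeMonoid ι →* FreeMonoid α :=
      FreeMonoid.lift (Function.update (fun z => h (FreeMonoid.of z)) y w)
    let φ : FreeMonoid ι →* FreeMonoid ι :=
      FreeMonoid.lift (Function.update FreeMonoid.of y (FreeMonoid.of x * FreeMonoid.of y))
    have hφ : h'.comp φ = h := by
      refine FreeMonoid.hom_eq fun z => ?_
      by_cases hz : z = y
      · subst hz; simp [h', φ, hxy, hy]
      · simp [h', φ, hz]
    have hlt : ∑ z, (h' (FreeMonoid.of z)).length < N := by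
      rw [← hN]
      refine Finset.sum_lt_sum (fun z _ => ?_) ⟨y, Finset.mem_univ _, ?_⟩
      · by_cases hz : z = y
        · subst hz; simp [h', hy]
        · simp [h', hz]
      · have : 0 < (h (FreeMonoid.of x)).length :=
          Nat.pos_of_ne_zero fun h0 => hx (FreeMonoid.length_eq_zero.1 h0)
        simpa [h', hy] using this
    obtain ⟨Y, hY, f, θ, h1, h2, h3⟩ := ih _ hlt h' rfl
    refine ⟨Y, hY, f.comp φ, θ, ?_, ?_, ?_⟩
    · rw [← MonoidHom.comp_assoc, h1, hφ]
    · intro u v huv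
      refine h2 _ _ ?_
      rw [← hφ] at huv
      exact huv
    · intro R _ _ c p hc hp
      have hother : ∀ z, z ≠ y → crossedHom c p (f (FreeMonoid.of z)) = 0 := by
        intro z hz
        simpa [φ, hz] using hp z
      refine h3 R c p hc fun z => ?_
      by_cases hz : z = y
      · subst hz
        -- Here `D (x * y) = D x + c(x) * D y` with `D x = 0` and `c(x) ≠ 0`, so `D y = 0`.
        have := hp z
        simp only [φ, MonoidHom.comp_apply, FreeMonoid.lift_eval_of, Function.update_self,
          map_mul, crossedHom_mul, hother x hxy, zero_add] at this
        exact (mul_eq_zero.1 this).resolve_left (lift_ne_zero hc _)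
      · exact hother z hz
  · push Not at hred
    -- No reduction applies: the nonempty values form a prefix code, so `θ` is injective, and `f`
    -- merely erases the unknowns with empty value.
    let Y := {x : ι // h (FreeMonoid.of x) ≠ 1}
    let f : FreeMonoid ι →* FreeMonoid Y :=
      FreeMonoid.lift fun x => if hx : h (FreeMonoid.of x) ≠ 1 then FreeMonoid.of ⟨x, hx⟩ else 1
    let θ : FreeMonoid Y →* FreeMonoid α := FreeMonoid.lift fun y => h (FreeMonoid.of y.1)
    have hθ : Function.Injective θ := by
      refine injective_of_prefix_free θ (fun y => by simpa [θ] using y.2) fun y z w hw => ?_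
      by_contra hyz
      exact hred y.1 z.1 w (fun e => hyz (Subtype.ext e)) y.2 (by simpa [θ] using hw)
    have hcomp : θ.comp f = h := by
      refine FreeMonoid.hom_eq fun z => ?_
      by_cases hz : h (FreeMonoid.of z) = 1
      · simp [f, hz]
      · simp [f, θ, hz]
    refine ⟨Y, inferInstance, f, θ, hcomp, fun u v huv => hθ ?_, fun R _ _ c p hc hp => ?_⟩
    · rw [← hcomp] at huv
      exact huv
    · funext y
      have := hp y.1
      simpa [f, y.2] using this

end Factorization

/-! ### Combinatorial rank -/

section Rank

variable {n : ℕ} {α : Type*}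

lemma morphismRank_le (h : FreeMonoid (Fin n) →* FreeMonoid α) (A : Finset (FreeMonoid α))
    (hA : ∀ x, h (FreeMonoid.of x) ∈ Submonoid.closure (A : Set (FreeMonoid α))) :
    morphismRank h ≤ A.card :=
  Nat.sInf_le ⟨A, rfl, hA⟩

lemma exists_card_eq_morphismRank (h : FreeMonoid (Fin n) →* FreeMonoid α) :
    ∃ A : Finset (FreeMonoid α), A.card = morphismRank h ∧
      ∀ x, h (FreeMonoid.of x) ∈ Submonoid.closure (A : Set (FreeMonoid α)) := by
  classical
  refine Nat.sInf_mem (s := {r : ℕ | ∃ A : Finset (FreeMonoid α), A.card = r ∧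
    ∀ x : Fin n, h (FreeMonoid.of x) ∈ Submonoid.closure (A : Set (FreeMonoid α))})
    ⟨_, Finset.univ.image fun x => h (FreeMonoid.of x), rfl, fun x => ?_⟩
  exact Submonoid.subset_closure (by simp)

lemma morphismRank_comp_le {Y : Type*} [Fintype Y] (f : FreeMonoid (Fin n) →* FreeMonoid Y)
    (θ : FreeMonoid Y →* FreeMonoid α) : morphismRank (θ.comp f) ≤ Fintype.card Y := by
  classical
  refine (morphismRank_le _ (Finset.univ.image fun y => θ (FreeMonoid.of y)) fun x => ?_).trans
    Finset.card_image_le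
  rw [MonoidHom.comp_apply]
  induction f (FreeMonoid.of x) using FreeMonoid.inductionOn' with
  | one => simp
  | of_mul a u ih =>
    rw [map_mul]
    exact mul_mem (Submonoid.subset_closure (by simp)) ih

/-- Two erased unknowns would leave at most `n - 2` generating words. This supplies the condition
under which nontrivial equations have nonzero rows. -/
lemma lengthType_ne_zero_of_rank (hn : 2 ≤ n) (h : FreeMonoid (Fin n) →* FreeMonoid α)
    (hr : morphismRank h = n - 1) (x y : Fin n) (hxy : x ≠ y) :
    lengthType h x ≠ 0 ∨ lengthType h y ≠ 0 := by
  classical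
  by_contra! hcon
  have hx : h (FreeMonoid.of x) = 1 := FreeMonoid.length_eq_zero.1 hcon.1
  have hy : h (FreeMonoid.of y) = 1 := FreeMonoid.length_eq_zero.1 hcon.2
  have := morphismRank_le h (((Finset.univ.erase x).erase y).image fun z => h (FreeMonoid.of z))
    fun z => by
      by_cases hzx : z = x
      · rw [hzx, hx]; exact one_mem _
      by_cases hzy : z = y
      · rw [hzy, hy]; exact one_mem _
      · refine Submonoid.subset_closure ?_
        simp only [Finset.coe_image, Set.mem_image, Finset.mem_coe]
        exact ⟨z, by simp [hzx, hzy], rfl⟩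
  have h2 := this.trans Finset.card_image_le
  rw [Finset.card_erase_of_mem (by simp [hxy.symm]), Finset.card_erase_of_mem (by simp),
    Finset.card_fin] at h2
  omega

/-- The alphabet has at least as many letters as the rank of a morphism. -/
lemma exists_embedding_of_card_le_rank {Y : Type*} [Fintype Y]
    (h : FreeMonoid (Fin n) →* FreeMonoid α) (hY : Fintype.card Y ≤ morphismRank h) :
    Nonempty (Y ↪ α) := by
  classical
  let B : Finset α := Finset.univ.biUnion fun x => (FreeMonoid.toList (h (FreeMonoid.of x))).toFinset
  have hB : morphismRank h ≤ B.card := by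
    refine (morphismRank_le h (B.image FreeMonoid.of) fun x => ?_).trans Finset.card_image_le
    have hsub : ∀ w : FreeMonoid α, (∀ a ∈ FreeMonoid.toList w, a ∈ B) →
        w ∈ Submonoid.closure ((B.image FreeMonoid.of : Finset (FreeMonoid α)) :
          Set (FreeMonoid α)) := by
      intro w
      induction w using FreeMonoid.inductionOn' with
      | one => intro _; exact one_mem _
      | of_mul a u ih =>
        intro hw
        refine mul_mem (Submonoid.subset_closure ?_) (ih fun b hb => hw b ?_)
        · exact Finset.mem_coe.2 (Finset.mem_image_of_mem _ (hw a (by simp)))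
        · simp [hb]
    refine hsub _ fun a ha => ?_
    simp only [B, Finset.mem_biUnion, List.mem_toFinset]
    exact ⟨x, Finset.mem_univ _, ha⟩
  obtain ⟨e⟩ : Nonempty (Y ↪ B) :=
    Function.Embedding.nonempty_of_card_le (by simpa using hY.trans hB)
  exact ⟨e.trans (Function.Embedding.subtype _)⟩

end Rank

/-! ### Proportionality of rows -/

section LinearAlgebra

variable {n : ℕ} {Y : Type} (f : FreeMonoid (Fin n) →* FreeMonoid Y)

/-- Restriction of crossed homomorphisms along `f`, as a linear map. -/
def crossedRestrict {R : Type*} [CommRing R] (c : Y → R) : (Y → R) →ₗ[R] (Fin n → R) where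
  toFun p x := crossedHom c p (f (FreeMonoid.of x))
  map_add' p q := funext fun _ => crossedHom_add c p q _
  map_smul' r p := funext fun _ => crossedHom_smul c p r _

@[simp] lemma crossedRestrict_apply {R : Type*} [CommRing R] (c p : Y → R) (x : Fin n) :
    crossedRestrict f c p x = crossedHom c p (f (FreeMonoid.of x)) := rfl

variable [Fintype Y]

/-- The rows orthogonal to all restrictions of crossed homomorphisms along `f`. -/
noncomputable def annihilatorRows {K : Type*} [Field K] (c : Y → K) : Submodule K (Fin n → K) :=
  open Classical in LinearMap.ker (LinearMap.toMatrix' (crossedRestrict f c)).transpose.mulVecLin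

/-- Rank-nullity for the transpose, whose rank is that of the injective restriction map. -/
lemma finrank_annihilatorRows {K : Type*} [Field K] (c : Y → K)
    (hinj : ∀ p, (∀ x, crossedHom c p (f (FreeMonoid.of x)) = 0) → p = 0) :
    Module.finrank K (annihilatorRows f c) + Fintype.card Y = n := by
  classical
  have hr : Module.finrank K (LinearMap.range (crossedRestrict f c)) = Fintype.card Y := by
    rw [LinearMap.finrank_range_of_inj, Module.finrank_fintype_fun_eq_card]
    rw [← LinearMap.ker_eq_bot, LinearMap.ker_eq_bot']
    intro p hp
    exact hinj p fun x => congrFun hp x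
  have h1 := LinearMap.finrank_range_add_finrank_ker
    (LinearMap.toMatrix' (crossedRestrict f c)).transpose.mulVecLin
  have h2 := (LinearMap.toMatrix' (crossedRestrict f c)).rank_transpose
  rw [Matrix.rank, Matrix.rank, ← Matrix.toLin'_apply' (LinearMap.toMatrix' _),
    Matrix.toLin'_toMatrix'] at h2
  rw [h2, hr, Module.finrank_fintype_fun_eq_card, Fintype.card_fin] at h1
  unfold annihilatorRows
  convert (add_comm _ _).trans h1

lemma row_mem_annihilatorRows {K : Type*} [Field K] (c : Y → K) (E : WordEquation n)
    (hE : f E.lhs = f E.rhs) :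
    E.row (fun x => FreeMonoid.lift c (f (FreeMonoid.of x))) ∈ annihilatorRows f c := by
  classical
  have h1 : ∀ p, ∑ x, E.row (fun x => FreeMonoid.lift c (f (FreeMonoid.of x))) x *
      crossedRestrict f c p x = 0 := by
    intro p
    rw [E.sum_row_mul, sub_eq_zero]
    have := congrArg (crossedHom c p) hE
    rwa [crossedHom_map, crossedHom_map] at this
  unfold annihilatorRows
  rw [LinearMap.mem_ker, Matrix.mulVecLin_apply]
  funext y
  rw [Matrix.mulVec, dotProduct, Pi.zero_apply, ← h1 (Pi.single y 1)]
  refine Finset.sum_congr rfl fun x _ => ?_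
  rw [Matrix.transpose_apply, LinearMap.toMatrix'_apply, mul_comm]

/-- With at least `n - 1` letters in `Y` the annihilator is at most a line, and both rows lie on it.
-/
lemma minors_eq_of_card {K : Type*} [Field K] (c : Y → K)
    (hinj : ∀ p, (∀ x, crossedHom c p (f (FreeMonoid.of x)) = 0) → p = 0)
    (hcard : n - 1 ≤ Fintype.card Y) (E E' : WordEquation n)
    (hE : f E.lhs = f E.rhs) (hE' : f E'.lhs = f E'.rhs) (x y : Fin n) :
    E.row (fun x => FreeMonoid.lift c (f (FreeMonoid.of x))) x *
      E'.row (fun x => FreeMonoid.lift c (f (FreeMonoid.of x))) y =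
    E.row (fun x => FreeMonoid.lift c (f (FreeMonoid.of x))) y *
      E'.row (fun x => FreeMonoid.lift c (f (FreeMonoid.of x))) x := by
  have h1 : Module.finrank K (annihilatorRows f c) ≤ 1 := by
    have := finrank_annihilatorRows f c hinj
    omega
  obtain ⟨v, hv⟩ := finrank_le_one_iff.1 h1
  obtain ⟨a, ha⟩ := hv ⟨_, row_mem_annihilatorRows f c E hE⟩
  obtain ⟨b, hb⟩ := hv ⟨_, row_mem_annihilatorRows f c E' hE'⟩
  replace ha := congrArg Subtype.val ha
  replace hb := congrArg Subtype.val hb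
  simp only [Submodule.coe_smul] at ha hb
  rw [← ha, ← hb]
  simp only [Pi.smul_apply, smul_eq_mul]
  ring

lemma card_lt_of_row_ne_zero {K : Type*} [Field K] (c : Y → K)
    (hinj : ∀ p, (∀ x, crossedHom c p (f (FreeMonoid.of x)) = 0) → p = 0)
    (E : WordEquation n) (hE : f E.lhs = f E.rhs)
    (hne : E.row (fun x => FreeMonoid.lift c (f (FreeMonoid.of x))) ≠ 0) :
    Fintype.card Y < n := by
  have h1 : 0 < Module.finrank K (annihilatorRows f c) := by
    rw [Module.finrank_pos_iff_exists_ne_zero]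
    exact ⟨⟨_, row_mem_annihilatorRows f c E hE⟩, fun h0 => hne (congrArg Subtype.val h0)⟩
  have := finrank_annihilatorRows f c hinj
  omega

end LinearAlgebra

/-! ### The space of length types of a factorization -/

section LengthSpace

variable {n : ℕ} {Y : Type} (f : FreeMonoid (Fin n) →* FreeMonoid Y)

/-- The space of length types of morphisms factoring through `f`. -/
def lengthSpace : Submodule ℚ (Fin n → ℚ) := LinearMap.range (crossedRestrict f (1 : Y → ℚ))

lemma length_eq_crossedHom {α R : Type*} [CommRing R] (θ : FreeMonoid Y →* FreeMonoid α)
    (w : FreeMonoid Y) :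
    ((θ w).length : R) = crossedHom 1 (fun y => ((θ (FreeMonoid.of y)).length : R)) w := by
  induction w using FreeMonoid.inductionOn' with
  | one => simp
  | of_mul a u ih => simp [ih]

lemma lengthType_mem_lengthSpace {α : Type*} (θ : FreeMonoid Y →* FreeMonoid α) :
    (fun x => (lengthType (θ.comp f) x : ℚ)) ∈ lengthSpace f :=
  ⟨fun y => ((θ (FreeMonoid.of y)).length : ℚ), funext fun x => by
    rw [crossedRestrict_apply, lengthType, MonoidHom.comp_apply, length_eq_crossedHom]⟩

lemma lift_zpow_eq {K : Type*} [Field K] {T : K} (hT : T ≠ 0) (μ : Y → ℤ) (w : FreeMonoid Y) :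
    FreeMonoid.lift (fun y => T ^ μ y) w = T ^ crossedHom 1 μ w := by
  induction w using FreeMonoid.inductionOn' with
  | one => simp
  | of_mul a u ih => simp [ih, zpow_add₀ hT]

open Polynomial

/-- A length type in the length space of `f` comes, up to scaling, from weights on the letters
of the intermediate alphabet. -/
lemma exists_weights_of_mem_lengthSpace [Fintype Y] (L : Fin n → ℕ)
    (hL : (fun x => (L x : ℚ)) ∈ lengthSpace f) :
    ∃ k : ℕ, k ≠ 0 ∧ ∃ c : Y → RatFunc ℚ, (∀ y, c y ≠ 0) ∧ ∀ x,
      FreeMonoid.lift c (f (FreeMonoid.of x)) =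
        algebraMap ℚ[X] (RatFunc ℚ) ((X : ℚ[X]) ^ (k * L x)) := by
  classical
  obtain ⟨ν, hν⟩ := hL
  -- The weights `ν` on `Y` are rational and possibly negative: `k` clears the denominators, and
  -- passing to `RatFunc ℚ` permits negative exponents.
  let k : ℕ := ∏ y, (ν y).den
  have hk : k ≠ 0 := Finset.prod_ne_zero_iff.2 fun y _ => (ν y).den_nz
  have hμ : ∀ y, ∃ z : ℤ, (z : ℚ) = k * ν y := by
    intro y
    obtain ⟨d, hd⟩ : (ν y).den ∣ k := Finset.dvd_prod_of_mem _ (Finset.mem_univ y)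
    refine ⟨d * (ν y).num, ?_⟩
    rw [hd]
    push_cast
    rw [← Rat.den_mul_eq_num]
    ring
  choose μ hμ using hμ
  have hX : (RatFunc.X : RatFunc ℚ) ≠ 0 := RatFunc.X_ne_zero
  refine ⟨k, hk, fun y => RatFunc.X ^ μ y, fun y => zpow_ne_zero _ hX, fun x => ?_⟩
  have h1 : crossedHom 1 μ (f (FreeMonoid.of x)) = (k * L x : ℕ) := by
    have h2 := map_crossedHom 1 μ (Int.castRingHom ℚ) (f (FreeMonoid.of x))
    have h3 : (fun y => (Int.castRingHom ℚ) (μ y)) = (k : ℚ) • ν := by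
      funext y; simp [hμ]
    have h4 : (fun y => (Int.castRingHom ℚ) ((1 : Y → ℤ) y)) = 1 := by
      funext y; simp
    rw [h3, h4, crossedHom_smul] at h2
    have h5 := congrFun hν x
    rw [crossedRestrict_apply] at h5
    rw [h5] at h2
    have h6 : ((crossedHom 1 μ (f (FreeMonoid.of x)) : ℤ) : ℚ) = ((k * L x : ℕ) : ℤ) := by
      simpa using h2
    exact_mod_cast h6
  rw [lift_zpow_eq hX, h1, zpow_natCast, map_pow, RatFunc.algebraMap_X]

end LengthSpace

/-! ### Generic length types and maximal rank -/

section Generic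

open MvPolynomial in
/-- Finitely many proper subspaces do not contain all vectors with positive integer entries. -/
lemma exists_pos_nat_notMem {Y κ : Type*} [Fintype Y] [Fintype κ]
    (W : κ → Submodule ℚ (Y → ℚ)) (hW : ∀ k, W k ≠ ⊤) :
    ∃ μ : Y → ℕ, (∀ y, 0 < μ y) ∧ ∀ k, (fun y => (μ y : ℚ)) ∉ W k := by
  classical
  have h1 : ∀ k, ∃ φ : Module.Dual ℚ (Y → ℚ), φ ≠ 0 ∧ W k ≤ LinearMap.ker φ :=
    fun k => (W k).exists_le_ker_of_lt_top (lt_top_iff_ne_top.2 (hW k))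
  choose φ hφ hker using h1
  have hφsum : ∀ k v, φ k v = ∑ y, φ k (Pi.single y 1) * v y := by
    intro k v
    rw [LinearMap.pi_apply_eq_sum_univ (φ k) v]
    refine Finset.sum_congr rfl fun y _ => ?_
    rw [smul_eq_mul, mul_comm]
    congr 2
    funext z
    simp [Pi.single_apply, eq_comm]
  let P : κ → MvPolynomial Y ℚ := fun k => ∑ y, C (φ k (Pi.single y 1)) * X y
  have hP : ∀ k v, eval v (P k) = φ k v := by
    intro k v
    simp [P, hφsum k v]
  -- Each subspace lies in the zero set of a nonzero linear polynomial; the product of these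
  -- polynomials cannot vanish on an infinite grid.
  have hne : ∏ k, P k ≠ 0 := by
    refine Finset.prod_ne_zero_iff.2 fun k _ h0 => hφ k (LinearMap.ext fun v => ?_)
    rw [← hP, h0]
    simp
  by_contra! hcon
  refine hne (MvPolynomial.funext_set (fun _ => Set.range fun a : ℕ => ((a + 1 : ℕ) : ℚ))
    (fun _ => Set.infinite_range_of_injective fun a b hab => by simpa using hab) fun v hv => ?_)
  choose μ hμ using fun y => hv y (Set.mem_univ y)
  obtain ⟨k, hk⟩ := hcon (fun y => μ y + 1) fun y => Nat.succ_pos _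
  rw [map_zero, map_prod]
  refine Finset.prod_eq_zero (Finset.mem_univ k) ?_
  rw [hP]
  have := hker k hk
  rw [LinearMap.mem_ker] at this
  rw [← this]
  congr 1
  funext y
  exact (hμ y).symm

end Generic

section MaximalRank

variable {n : ℕ} {α : Type*} {Y : Type} [Fintype Y]

lemma finrank_lengthSpace (f : FreeMonoid (Fin n) →* FreeMonoid Y)
    (hinj : ∀ p : Y → ℚ, (∀ x, crossedHom 1 p (f (FreeMonoid.of x)) = 0) → p = 0) :
    Module.finrank ℚ (lengthSpace f) = Fintype.card Y := by
  unfold lengthSpace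
  rw [LinearMap.finrank_range_of_inj, Module.finrank_fintype_fun_eq_card]
  rw [← LinearMap.ker_eq_bot, LinearMap.ker_eq_bot']
  intro p hp
  exact hinj p fun x => congrFun hp x

/-- A morphism sending each letter to a power of its own letter of the target alphabet does not
decrease the rank. -/
lemma card_le_morphismRank (f : FreeMonoid (Fin n) →* FreeMonoid Y)
    (hinj : ∀ p : Y → ℚ, (∀ x, crossedHom 1 p (f (FreeMonoid.of x)) = 0) → p = 0)
    (e : Y ↪ α) (μ : Y → ℕ) (hμ : ∀ y, 0 < μ y) :
    Fintype.card Y ≤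
      morphismRank ((FreeMonoid.lift fun y => FreeMonoid.of (e y) ^ μ y).comp f) := by
  classical
  set g : FreeMonoid Y →* FreeMonoid α := FreeMonoid.lift fun y => FreeMonoid.of (e y) ^ μ y
  obtain ⟨A, hA, hcl⟩ := exists_card_eq_morphismRank (g.comp f)
  rw [← hA]
  -- With weights 1 crossed homomorphisms are additive, so one vanishing on `A` vanishes on the
  -- words it generates, in particular on the values of `g.comp f`. Injectivity of restriction along
  -- `f` then embeds `Y → ℚ` into `A → ℚ`.
  let ext : (Y → ℚ) → α → ℚ := fun p => Function.extend e p 0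
  let Φ : (Y → ℚ) →ₗ[ℚ] (A → ℚ) :=
    { toFun p w := crossedHom 1 (ext p) w
      map_add' p q := by
        funext w
        rw [Pi.add_apply, ← crossedHom_add]
        congr 1
        simp only [ext]
        rw [← Function.extend_add, add_zero]
      map_smul' r p := by
        funext w
        rw [RingHom.id_apply, Pi.smul_apply, smul_eq_mul, ← crossedHom_smul]
        congr 1
        simp only [ext]
        rw [← Function.extend_smul, smul_zero] }
  have hmul : ∀ (p : Y → ℚ) (u v : FreeMonoid α), crossedHom 1 (ext p) (u * v) =
      crossedHom 1 (ext p) u + crossedHom 1 (ext p) v := by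
    intro p u v
    rw [crossedHom_mul]
    have : FreeMonoid.lift (1 : α → ℚ) u = 1 := by
      induction u using FreeMonoid.inductionOn' with
      | one => simp
      | of_mul a u ih => simp [ih]
    rw [this, one_mul]
  have hpow : ∀ (p : Y → ℚ) (y : Y) (k : ℕ),
      crossedHom 1 (ext p) (FreeMonoid.of (e y) ^ k) = k * p y := by
    intro p y k
    induction k with
    | zero => simp
    | succ k ih =>
      rw [pow_succ, hmul, ih, crossedHom_of]
      simp only [ext, e.injective.extend_apply]
      push_cast
      ring
  have hg : ∀ (p : Y → ℚ) (w : FreeMonoid Y),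
      crossedHom 1 (ext p) (g w) = crossedHom 1 (fun y => μ y * p y) w := by
    intro p w
    induction w using FreeMonoid.inductionOn' with
    | one => simp
    | of_mul a u ih =>
      rw [map_mul, hmul, ih, crossedHom_of_mul]
      simp [g, hpow]
  have hΦ : Function.Injective Φ := by
    rw [← LinearMap.ker_eq_bot, LinearMap.ker_eq_bot']
    intro p hp
    have hA0 : ∀ w ∈ Submonoid.closure (A : Set (FreeMonoid α)), crossedHom 1 (ext p) w = 0 := by
      intro w hw
      induction hw using Submonoid.closure_induction with
      | mem w hw => exact congrFun hp ⟨w, hw⟩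
      | one => simp
      | mul u v _ _ hu hv => rw [hmul, hu, hv, add_zero]
    have h0 := hinj (fun y => μ y * p y) fun x => by
      rw [← hg]
      exact hA0 _ (hcl x)
    funext y
    have := congrFun h0 y
    simpa [(hμ y).ne'] using this
  have := LinearMap.finrank_le_finrank_of_injective hΦ
  simpa using this

/-- If finitely many subspaces cover the length types of the morphisms of rank `card Y` factoring
through `f`, then one of them contains the whole length space. -/
lemma exists_lengthSpace_le {κ : Type*} [Fintype κ] (f : FreeMonoid (Fin n) →* FreeMonoid Y)
    (hinj : ∀ p : Y → ℚ, (∀ x, crossedHom 1 p (f (FreeMonoid.of x)) = 0) → p = 0)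
    (e : Y ↪ α) (V : κ → Submodule ℚ (Fin n → ℚ))
    (hV : ∀ g : FreeMonoid Y →* FreeMonoid α, morphismRank (g.comp f) = Fintype.card Y →
      ∃ k, (fun x => (lengthType (g.comp f) x : ℚ)) ∈ V k) :
    ∃ k, lengthSpace f ≤ V k := by
  by_contra! hcon
  obtain ⟨μ, hμ, hμV⟩ := exists_pos_nat_notMem
    (fun k => (V k).comap (crossedRestrict f (1 : Y → ℚ))) fun k htop => hcon k (by
      rintro _ ⟨p, rfl⟩
      have : p ∈ (V k).comap (crossedRestrict f (1 : Y → ℚ)) := by rw [htop]; trivial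
      exact this)
  obtain ⟨k, hk⟩ := hV (FreeMonoid.lift fun y => FreeMonoid.of (e y) ^ μ y)
    (le_antisymm (morphismRank_comp_le _ _) (card_le_morphismRank f hinj e μ hμ))
  refine hμV k ?_
  rw [Submodule.mem_comap]
  convert hk using 1
  funext x
  rw [crossedRestrict_apply, lengthType, MonoidHom.comp_apply, length_eq_crossedHom]
  congr 1
  funext y
  rw [FreeMonoid.lift_eval_of]
  generalize μ y = k
  induction k with
  | zero => simp
  | succ k ih => rw [pow_succ, FreeMonoid.length_mul]; push_cast; rw [← ih]; simp

open Polynomial in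
/-- The data attached to a morphism of rank `n - 1` solving a nontrivial equation: the
`(n - 1)`-dimensional space `U` of length types of its family, on which the rows of any two
equations satisfied by the morphism are proportional. -/
theorem exists_space_of_rank (hn : 2 ≤ n) (h : FreeMonoid (Fin n) →* FreeMonoid α)
    (hr : morphismRank h = n - 1) (E₀ : WordEquation n) (hE₀ : ¬ E₀.IsTrivial)
    (hs : E₀.IsSolution h) :
    ∃ U : Submodule ℚ (Fin n → ℚ), Module.finrank ℚ U = n - 1 ∧
      (fun x => (lengthType h x : ℚ)) ∈ U ∧
      (∀ E E' : WordEquation n, E.IsSolution h → E'.IsSolution h → ∀ L : Fin n → ℕ,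
        (fun x => (L x : ℚ)) ∈ U → ∃ k : ℕ, k ≠ 0 ∧ ∀ x y,
          E.row (fun x => (X : ℚ[X]) ^ (k * L x)) x * E'.row (fun x => (X : ℚ[X]) ^ (k * L x)) y =
          E.row (fun x => (X : ℚ[X]) ^ (k * L x)) y *
            E'.row (fun x => (X : ℚ[X]) ^ (k * L x)) x) ∧
      ∀ (κ : Type) [Fintype κ] (V : κ → Submodule ℚ (Fin n → ℚ)) (S : Set (WordEquation n)),
        (∀ E ∈ S, E.IsSolution h) →
        (∀ h' ∈ rankSol α (n - 1) S, ∃ k, (fun x => (lengthType h' x : ℚ)) ∈ V k) →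
        ∃ k, U ≤ V k := by
  obtain ⟨Y, _, f, θ, rfl, heq, hinj⟩ := exists_factorization h
  have hinj1 : ∀ p : Y → ℚ, (∀ x, crossedHom 1 p (f (FreeMonoid.of x)) = 0) → p = 0 :=
    fun p hp => hinj ℚ 1 p (fun _ => one_ne_zero) hp
  have hle : n - 1 ≤ Fintype.card Y := hr ▸ morphismRank_comp_le f θ
  have hmap : Function.Injective (algebraMap ℚ[X] (RatFunc ℚ)) := RatFunc.algebraMap_injective ℚ
  have hrow : ∀ (E : WordEquation n) (L : Fin n → ℕ) (k : ℕ) (c : Y → RatFunc ℚ),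
      (∀ x, FreeMonoid.lift c (f (FreeMonoid.of x)) =
        algebraMap ℚ[X] (RatFunc ℚ) ((X : ℚ[X]) ^ (k * L x))) → ∀ x,
      E.row (fun x => FreeMonoid.lift c (f (FreeMonoid.of x))) x =
        algebraMap ℚ[X] (RatFunc ℚ) (E.row (fun x => (X : ℚ[X]) ^ (k * L x)) x) := by
    intro E L k c hc x
    rw [WordEquation.map_row]
    simp only [hc]
  -- The nonzero row of `E₀` at the length type of `h` makes the annihilator nontrivial; with `hle`,
  -- this pins the number of letters to `n - 1`.
  have hlt : Fintype.card Y < n := by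
    obtain ⟨k, hk, c, hc0, hc⟩ := exists_weights_of_mem_lengthSpace f
      (lengthType (θ.comp f)) (lengthType_mem_lengthSpace f θ)
    refine card_lt_of_row_ne_zero f c (fun p => hinj _ c p hc0) E₀ (heq _ _ hs) fun h0 => ?_
    obtain ⟨x, hx⟩ := E₀.exists_row_ne_zero hE₀ (fun x => k * lengthType (θ.comp f) x) (by
      simpa [hk] using lengthType_ne_zero_of_rank hn _ hr)
    refine hx (hmap ?_)
    rw [← hrow E₀ _ k c hc x, h0]
    simp
  have hcard : Fintype.card Y = n - 1 := by omega
  refine ⟨lengthSpace f, (finrank_lengthSpace f hinj1).trans hcard,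
    lengthType_mem_lengthSpace f θ, ?_, ?_⟩
  · intro E E' hE hE' L hL
    obtain ⟨k, hk, c, hc0, hc⟩ := exists_weights_of_mem_lengthSpace f L hL
    refine ⟨k, hk, fun x y => hmap ?_⟩
    have := minors_eq_of_card f c (fun p => hinj _ c p hc0) hle E E' (heq _ _ hE) (heq _ _ hE') x y
    simpa only [hrow _ L k c hc, map_mul] using this
  · intro κ _ V S hS hV
    obtain ⟨e⟩ := exists_embedding_of_card_le_rank (Y := Y) (θ.comp f) (by omega)
    refine exists_lengthSpace_le f hinj1 e V fun g hg => hV _ ⟨hg.trans hcard, fun E hE => ?_⟩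
    exact congrArg g (heq _ _ (hS E hE))

end MaximalRank

/-! ### Chains of linear forms and least exponents -/

section LinearForms

variable {ι : Type*} [Fintype ι]

/-- The value of the linear form with coefficients `v` at `L`. -/
def formValue (L v : ι → ℕ) : ℕ := ∑ i, v i * L i

lemma formValue_add (L v w : ι → ℕ) : formValue L (v + w) = formValue L v + formValue L w := by
  simp [formValue, add_mul, Finset.sum_add_distrib]

lemma formValue_mono (L : ι → ℕ) {v w : ι → ℕ} (h : v ≤ w) : formValue L v ≤ formValue L w :=
  Finset.sum_le_sum fun i _ => Nat.mul_le_mul_right _ (h i)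

/-- The first form in the list `l` occurring more often in `s` than in `t`. -/
def firstExcess [DecidableEq ι] (s t : Multiset (ι → ℕ)) (l : List (ι → ℕ)) : ι → ℕ :=
  (l.find? fun v => t.count v < s.count v).getD 0

/-- Values at `L` increase along a chain, so the first survivor of a chain containing a minimal form
is minimal too. The first survivor does not depend on `L`, which is why finitely many pairs will do.
-/
lemma exists_firstExcess_minimal [DecidableEq ι] (C : List (List (ι → ℕ)))
    (hC : ∀ l ∈ C, l.Pairwise (· ≤ ·)) (t : Multiset (ι → ℕ)) (L v : ι → ℕ)
    (hv : v ∈ (C.flatten : Multiset (ι → ℕ)) - t)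
    (hmin : ∀ w ∈ (C.flatten : Multiset (ι → ℕ)) - t, formValue L v ≤ formValue L w) :
    ∃ i : Fin C.length, firstExcess C.flatten t C[i] ∈ (C.flatten : Multiset (ι → ℕ)) - t ∧
      formValue L (firstExcess C.flatten t C[i]) = formValue L v := by
  have hmem : ∀ w, w ∈ (C.flatten : Multiset (ι → ℕ)) - t ↔
      t.count w < (C.flatten : Multiset (ι → ℕ)).count w := fun w => Multiset.mem_sub
  have hv' := (hmem v).1 hv
  obtain ⟨l, hl, hvl⟩ := List.mem_flatten.1
    (Multiset.mem_coe.1 (Multiset.count_pos.1 (lt_of_le_of_lt (Nat.zero_le _) hv')))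
  obtain ⟨i, hi, rfl⟩ := List.mem_iff_getElem.1 hl
  refine ⟨⟨i, hi⟩, ?_⟩
  have hsome : ((C[i]).find? fun v => t.count v < (C.flatten : Multiset (ι → ℕ)).count v).isSome :=
    List.find?_isSome.2 ⟨v, hvl, by simpa using hv'⟩
  obtain ⟨w, hw⟩ := Option.isSome_iff_exists.1 hsome
  have hfe : firstExcess C.flatten t C[i] = w := by
    unfold firstExcess
    rw [hw]
    rfl
  obtain ⟨hpw, as, bs, heq, has⟩ := List.find?_eq_some_iff_append.1 hw
  have hpw' : t.count w < (C.flatten : Multiset (ι → ℕ)).count w := by simpa using hpw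
  have hwmem := (hmem w).2 hpw'
  have hle : w ≤ v := by
    have hp := hC _ hl
    rw [heq] at hp hvl
    rcases List.mem_append.1 hvl with h1 | h1
    · exact absurd hv' (by simpa using has v h1)
    · rcases List.mem_cons.1 h1 with h2 | h2
      · exact h2 ▸ le_rfl
      · exact (List.pairwise_cons.1 (List.pairwise_append.1 hp).2.1).1 v h2
  change firstExcess C.flatten t C[i] ∈ _ ∧ formValue L (firstExcess C.flatten t C[i]) = _
  rw [hfe]
  exact ⟨hwmem, le_antisymm (formValue_mono L hle) (hmin w hwmem)⟩

/-- If two families of increasing chains of linear forms have different elements, but the same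
values at `L`, then the first surviving elements of some two chains, one from each family, are
different forms with the same value at `L`. -/
lemma exists_firstExcess_eq [DecidableEq ι] (C D : List (List (ι → ℕ)))
    (hC : ∀ l ∈ C, l.Pairwise (· ≤ ·)) (hD : ∀ l ∈ D, l.Pairwise (· ≤ ·))
    (hne : (C.flatten : Multiset (ι → ℕ)) ≠ D.flatten) (L : ι → ℕ)
    (hL : (C.flatten : Multiset (ι → ℕ)).map (formValue L) =
      (D.flatten : Multiset (ι → ℕ)).map (formValue L)) :
    ∃ (i : Fin C.length) (j : Fin D.length),
      firstExcess C.flatten D.flatten C[i] ≠ firstExcess D.flatten C.flatten D[j] ∧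
      formValue L (firstExcess C.flatten D.flatten C[i]) =
        formValue L (firstExcess D.flatten C.flatten D[j]) := by
  set s : Multiset (ι → ℕ) := ((C.flatten : List (ι → ℕ)) : Multiset (ι → ℕ)) with hs
  set t : Multiset (ι → ℕ) := ((D.flatten : List (ι → ℕ)) : Multiset (ι → ℕ)) with ht
  have hs' : s - t + s ∩ t = s := Multiset.sub_add_inter s t
  have ht' : t - s + s ∩ t = t := Multiset.inter_comm t s ▸ Multiset.sub_add_inter t s
  -- Forms common to both families are cancelled, so the remaining multisets are disjoint but still
  -- have the same values at `L`.
  have hmap : (s - t).map (formValue L) = (t - s).map (formValue L) := by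
    refine add_right_cancel (b := (s ∩ t).map (formValue L)) ?_
    rw [← Multiset.map_add, ← Multiset.map_add, hs', ht', hL]
  have hst : s - t ≠ 0 := by
    intro h0
    have h1 : t - s = 0 := by
      rw [h0, Multiset.map_zero] at hmap
      exact Multiset.map_eq_zero.1 hmap.symm
    refine hne ?_
    exact hs'.symm.trans ((congrArg (· + s ∩ t) (h0.trans h1.symm)).trans ht')
  have hts : t - s ≠ 0 := by
    intro h0
    rw [h0, Multiset.map_zero] at hmap
    exact hst (Multiset.map_eq_zero.1 hmap)
  have hminimal : ∀ r : Multiset (ι → ℕ), r ≠ 0 →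
      ∃ v ∈ r, ∀ w ∈ r, formValue L v ≤ formValue L w := by
    intro r hr
    obtain ⟨v, hv, hmin⟩ := r.toFinset.exists_min_image (formValue L)
      (Multiset.toFinset_nonempty.2 hr)
    exact ⟨v, Multiset.mem_toFinset.1 hv, fun w hw => hmin w (Multiset.mem_toFinset.2 hw)⟩
  obtain ⟨v, hv, hvmin⟩ := hminimal _ hst
  obtain ⟨w, hw, hwmin⟩ := hminimal _ hts
  have hvw : formValue L v = formValue L w := by
    refine le_antisymm ?_ ?_
    · have := Multiset.mem_map_of_mem (formValue L) hw
      rw [← hmap] at this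
      obtain ⟨u, hu, hu'⟩ := Multiset.mem_map.1 this
      exact hu' ▸ hvmin u hu
    · have := Multiset.mem_map_of_mem (formValue L) hv
      rw [hmap] at this
      obtain ⟨u, hu, hu'⟩ := Multiset.mem_map.1 this
      exact hu' ▸ hwmin u hu
  obtain ⟨i, hi, hi'⟩ := exists_firstExcess_minimal C hC t L v hv hvmin
  obtain ⟨j, hj, hj'⟩ := exists_firstExcess_minimal D hD s L w hw hwmin
  refine ⟨i, j, fun heq => ?_, hi'.trans (hvw.trans hj'.symm)⟩
  rw [heq] at hi
  exact lt_asymm (Multiset.mem_sub.1 hi) (Multiset.mem_sub.1 hj)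

end LinearForms

section Chains

variable {ι : Type*}

/-- The chains of sums of a form from `A` and the forms from `B`. -/
def chains (A B : List (ι → ℕ)) : List (List (ι → ℕ)) := A.map fun v => B.map (v + ·)

lemma pairwise_of_mem_chains {A B : List (ι → ℕ)} (hB : B.Pairwise (· ≤ ·)) {l : List (ι → ℕ)}
    (hl : l ∈ chains A B) : l.Pairwise (· ≤ ·) := by
  obtain ⟨v, _, rfl⟩ := List.mem_map.1 hl
  exact List.Pairwise.map _ (fun _ _ h => add_le_add_right h v) hB

end Chains

section FormSum

variable {ι : Type*} [Fintype ι]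

open Polynomial

/-- The sum of the powers of `X` with exponents the values at `L` of the forms in a list. -/
noncomputable def formSum (L : ι → ℕ) (l : List (ι → ℕ)) : ℚ[X] :=
  (l.map fun v => (X : ℚ[X]) ^ formValue L v).sum

lemma formSum_append (L : ι → ℕ) (A B : List (ι → ℕ)) :
    formSum L (A ++ B) = formSum L A + formSum L B := by
  simp [formSum]

lemma formSum_map_add (L v : ι → ℕ) (B : List (ι → ℕ)) :
    formSum L (B.map (v + ·)) = X ^ formValue L v * formSum L B := by
  induction B with
  | nil => simp [formSum]
  | cons b B ih =>
    simp only [formSum, List.map_cons, List.sum_cons] at ih ⊢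
    rw [ih, formValue_add, pow_add, mul_add]

lemma formSum_flatten_chains (L : ι → ℕ) (A B : List (ι → ℕ)) :
    formSum L (chains A B).flatten = formSum L A * formSum L B := by
  induction A with
  | nil => simp [formSum, chains]
  | cons a A ih =>
    rw [chains, List.map_cons, List.flatten_cons, formSum_append, formSum_map_add]
    rw [chains] at ih
    rw [ih]
    simp only [formSum, List.map_cons, List.sum_cons]
    ring

lemma coeff_formSum (L : ι → ℕ) (l : List (ι → ℕ)) (k : ℕ) :
    (formSum L l).coeff k = ((l : Multiset (ι → ℕ)).map (formValue L)).count k := by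
  induction l with
  | nil => simp [formSum]
  | cons a l ih =>
    simp only [formSum, List.map_cons, List.sum_cons] at ih ⊢
    rw [coeff_add, ih, coeff_X_pow, ← Multiset.cons_coe, Multiset.map_cons, Multiset.count_cons]
    push_cast
    ring

lemma formSum_eq_iff (L : ι → ℕ) (l l' : List (ι → ℕ)) : formSum L l = formSum L l' ↔
    (l : Multiset (ι → ℕ)).map (formValue L) = (l' : Multiset (ι → ℕ)).map (formValue L) := by
  constructor
  · intro h
    ext k
    have := congrArg (fun p => p.coeff k) h
    simpa only [coeff_formSum, Nat.cast_inj] using this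
  · intro h
    ext k
    rw [coeff_formSum, coeff_formSum, h]

end FormSum

/-! ### Occurrences as linear forms, and the hyperplanes of a minor -/

section Occurrences

variable {n : ℕ}

/-- The positions of the occurrences of `x` in `w`, as linear forms in the lengths of the
unknowns. -/
def occForms (x : Fin n) (w : FreeMonoid (Fin n)) : List (Fin n → ℕ) :=
  (FreeMonoid.toList w).foldr
    (fun a l => (if a = x then [0] else []) ++ l.map (Pi.single a 1 + ·)) []

@[simp] lemma occForms_one (x : Fin n) : occForms x 1 = [] := rfl

@[simp] lemma occForms_of_mul (x a : Fin n) (w : FreeMonoid (Fin n)) :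
    occForms x (FreeMonoid.of a * w) =
      (if a = x then [0] else []) ++ (occForms x w).map (Pi.single a 1 + ·) := rfl

lemma length_occForms (x : Fin n) (w : FreeMonoid (Fin n)) :
    (occForms x w).length = (FreeMonoid.toList w).count x := by
  induction w using FreeMonoid.inductionOn' with
  | one => simp
  | of_mul a u ih =>
    rw [occForms_of_mul, List.length_append, List.length_map, ih, FreeMonoid.toList_of_mul,
      List.count_cons]
    by_cases h : a = x <;> simp [h, add_comm]

lemma pairwise_occForms (x : Fin n) (w : FreeMonoid (Fin n)) :
    (occForms x w).Pairwise (· ≤ ·) := by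
  induction w using FreeMonoid.inductionOn' with
  | one => simp
  | of_mul a u ih =>
    have h1 : ((occForms x u).map (Pi.single a 1 + ·)).Pairwise (· ≤ ·) :=
      List.Pairwise.map _ (fun _ _ h => add_le_add_right h _) ih
    rw [occForms_of_mul]
    by_cases h : a = x
    · rw [if_pos h, List.singleton_append, List.pairwise_cons]
      exact ⟨fun v _ => zero_le, h1⟩
    · rwa [if_neg h, List.nil_append]

open Polynomial in
lemma crossedHom_single_eq_formSum (L : Fin n → ℕ) (x : Fin n) (w : FreeMonoid (Fin n)) :
    crossedHom (fun a => (X : ℚ[X]) ^ L a) (Pi.single x 1) w = formSum L (occForms x w) := by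
  induction w using FreeMonoid.inductionOn' with
  | one => simp [formSum]
  | of_mul a u ih =>
    have h1 : formValue L (Pi.single a 1) = L a := by
      simp [formValue, Pi.single_apply]
    rw [crossedHom_of_mul, occForms_of_mul, formSum_append, formSum_map_add, ih, h1]
    congr 1
    by_cases h : a = x
    · subst h; simp [formSum, formValue]
    · simp [h, formSum]

end Occurrences

section Hyperplanes

variable {n : ℕ}

/-- The subspace of vectors on which two linear forms agree. -/
noncomputable def formsEqSpace (v w : Fin n → ℕ) : Submodule ℚ (Fin n → ℚ) :=
  LinearMap.ker (∑ i, ((v i : ℚ) - w i) • (LinearMap.proj i : (Fin n → ℚ) →ₗ[ℚ] ℚ))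

lemma mem_formsEqSpace {v w L : Fin n → ℕ} (h : formValue L v = formValue L w) :
    (fun i => (L i : ℚ)) ∈ formsEqSpace v w := by
  rw [formsEqSpace, LinearMap.mem_ker]
  have h2 : ((formValue L v : ℕ) : ℚ) = (formValue L w : ℕ) := congrArg _ h
  simp only [formValue, Nat.cast_sum, Nat.cast_mul] at h2
  simp [sub_mul, Finset.sum_sub_distrib, h2]

lemma finrank_formsEqSpace {v w : Fin n → ℕ} (h : v ≠ w) :
    Module.finrank ℚ (formsEqSpace v w) = n - 1 := by
  have hne : (∑ i, ((v i : ℚ) - w i) • (LinearMap.proj i : (Fin n → ℚ) →ₗ[ℚ] ℚ)) ≠ 0 := by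
    intro h0
    refine h (funext fun i => ?_)
    have := LinearMap.congr_fun h0 (Pi.single i 1)
    simp only [LinearMap.sum_apply, LinearMap.smul_apply, LinearMap.proj_apply, smul_eq_mul,
      Pi.single_apply, mul_ite, mul_one, mul_zero, Finset.sum_ite_eq', Finset.mem_univ, if_true,
      LinearMap.zero_apply, sub_eq_zero] at this
    exact_mod_cast this
  have := Module.Dual.finrank_ker_add_one_of_ne_zero hne
  rw [Module.finrank_fintype_fun_eq_card, Fintype.card_fin] at this
  exact Nat.eq_sub_of_add_eq this

lemma exists_hyperplanes_of_chains (x : Fin n) (C D : List (List (Fin n → ℕ)))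
    (hC : ∀ l ∈ C, l.Pairwise (· ≤ ·)) (hD : ∀ l ∈ D, l.Pairwise (· ≤ ·))
    (hne : (C.flatten : Multiset (Fin n → ℕ)) ≠ D.flatten) :
    ∃ V : Fin C.length × Fin D.length → Submodule ℚ (Fin n → ℚ),
      (∀ k, Module.finrank ℚ (V k) = n - 1) ∧
      ∀ L : Fin n → ℕ, (C.flatten : Multiset (Fin n → ℕ)).map (formValue L) =
        (D.flatten : Multiset (Fin n → ℕ)).map (formValue L) →
        ∃ k, (fun x => (L x : ℚ)) ∈ V k := by
  have : ∀ k : Fin C.length × Fin D.length, ∃ W : Submodule ℚ (Fin n → ℚ),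
      Module.finrank ℚ W = n - 1 ∧
      (firstExcess C.flatten D.flatten C[k.1] ≠ firstExcess D.flatten C.flatten D[k.2] →
        W = formsEqSpace (firstExcess C.flatten D.flatten C[k.1])
          (firstExcess D.flatten C.flatten D[k.2])) := by
    intro k
    by_cases h : firstExcess C.flatten D.flatten C[k.1] = firstExcess D.flatten C.flatten D[k.2]
    -- This pair is never the one needed, for instance when both chains have no survivor and default
    -- to 0; an arbitrary hyperplane fills the slot.
    · exact ⟨formsEqSpace (Pi.single x 1) 0, finrank_formsEqSpace (by simp),
        fun hn => absurd h hn⟩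
    · exact ⟨_, finrank_formsEqSpace h, fun _ => rfl⟩
  choose V hV hV' using this
  refine ⟨V, hV, fun L hL => ?_⟩
  obtain ⟨i, j, hij, hval⟩ := exists_firstExcess_eq C D hC hD hne L hL
  refine ⟨(i, j), ?_⟩
  rw [hV' (i, j) hij]
  exact mem_formsEqSpace hval

end Hyperplanes

namespace WordEquation

variable {n : ℕ} (E E' : WordEquation n) (x y : Fin n)

/-- The chains of forms occurring positively in a minor of the rows of `E` and `E'`. -/
def posChains : List (List (Fin n → ℕ)) :=
  chains (occForms x E.lhs) (occForms y E'.lhs) ++ chains (occForms x E.rhs) (occForms y E'.rhs) ++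
    (chains (occForms y E.lhs) (occForms x E'.rhs) ++ chains (occForms y E.rhs) (occForms x E'.lhs))

/-- Each chain fixes one occurrence in `E` and runs through occurrences in `E'`, so the number of
chains does not depend on `E'`. -/
lemma length_posChains : (E.posChains E' x y).length = E.occ x + E.occ y := by
  simp [posChains, chains, length_occForms, occ, add_assoc]

lemma pairwise_of_mem_posChains : ∀ l ∈ E.posChains E' x y, l.Pairwise (· ≤ ·) := by
  intro l hl
  simp only [posChains, List.mem_append] at hl
  rcases hl with (h | h) | (h | h) <;> exact pairwise_of_mem_chains (pairwise_occForms _ _) h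

open Polynomial

/-- Swapping `x` and `y` negates the minor, so its negative terms are the positive terms of the
swapped one. -/
lemma minor_eq_formSum_sub (L : Fin n → ℕ) :
    E.row (fun a => (X : ℚ[X]) ^ L a) x * E'.row (fun a => (X : ℚ[X]) ^ L a) y -
      E.row (fun a => (X : ℚ[X]) ^ L a) y * E'.row (fun a => (X : ℚ[X]) ^ L a) x =
    formSum L (E.posChains E' x y).flatten - formSum L (E.posChains E' y x).flatten := by
  simp only [row, posChains, List.flatten_append, formSum_append, formSum_flatten_chains,
    crossedHom_single_eq_formSum]
  ring

/-- If a minor of the rows of `E` and `E'` does not vanish identically, then the length types at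
which it vanishes are covered by `(|E|_x + |E|_y)^2` hyperplanes. -/
theorem exists_hyperplanes (L₀ : Fin n → ℕ)
    (hL₀ : E.row (fun a => (X : ℚ[X]) ^ L₀ a) x * E'.row (fun a => (X : ℚ[X]) ^ L₀ a) y ≠
      E.row (fun a => (X : ℚ[X]) ^ L₀ a) y * E'.row (fun a => (X : ℚ[X]) ^ L₀ a) x) :
    ∃ V : Fin (E.occ x + E.occ y) × Fin (E.occ x + E.occ y) → Submodule ℚ (Fin n → ℚ),
      (∀ k, Module.finrank ℚ (V k) = n - 1) ∧
      ∀ L : Fin n → ℕ,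
        E.row (fun a => (X : ℚ[X]) ^ L a) x * E'.row (fun a => (X : ℚ[X]) ^ L a) y =
          E.row (fun a => (X : ℚ[X]) ^ L a) y * E'.row (fun a => (X : ℚ[X]) ^ L a) x →
        ∃ k, (fun x => (L x : ℚ)) ∈ V k := by
  have hne : ((E.posChains E' x y).flatten : Multiset (Fin n → ℕ)) ≠
      (E.posChains E' y x).flatten := by
    intro h
    refine hL₀ (sub_eq_zero.1 ?_)
    rw [minor_eq_formSum_sub, sub_eq_zero, formSum_eq_iff, h]
  obtain ⟨V, hV, hcover⟩ := exists_hyperplanes_of_chains x _ _ (E.pairwise_of_mem_posChains E' x y)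
    (E.pairwise_of_mem_posChains E' y x) hne
  have hC : (E.posChains E' x y).length = E.occ x + E.occ y := E.length_posChains E' x y
  have hD : (E.posChains E' y x).length = E.occ x + E.occ y := by rw [length_posChains, add_comm]
  refine ⟨fun k => V (Fin.cast hC.symm k.1, Fin.cast hD.symm k.2), fun k => hV _, fun L hL => ?_⟩
  rw [← sub_eq_zero, minor_eq_formSum_sub, sub_eq_zero, formSum_eq_iff] at hL
  obtain ⟨k, hk⟩ := hcover L hL
  exact ⟨(Fin.cast hC k.1, Fin.cast hD k.2), hk⟩

end WordEquation

/-! ### Bounding the chain of solution sets -/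

section Chain

variable {n m : ℕ} {α : Type*}

lemma exists_separating_solution {r : ℕ} (E : Fin m → WordEquation n)
    (hchain : ∀ i j : Fin m, i < j → rankSol α r (E '' Set.Iic j) ⊂ rankSol α r (E '' Set.Iic i))
    (hnonempty : (rankSol α r (Set.range E)).Nonempty) (i : Fin m) :
    ∃ h : FreeMonoid (Fin n) →* FreeMonoid α, morphismRank h = r ∧
      (∀ j ≤ i, (E j).IsSolution h) ∧
      ∀ hi : i.val + 1 < m, ¬ (E ⟨i.val + 1, hi⟩).IsSolution h := by
  by_cases hi : i.val + 1 < m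
  · obtain ⟨h, ⟨hr, hs⟩, hns⟩ := Set.exists_of_ssubset (hchain i ⟨i.val + 1, hi⟩
      (Fin.lt_def.2 (Nat.lt_succ_self _)))
    refine ⟨h, hr, fun j hj => hs _ ⟨j, hj, rfl⟩, fun _ hsol => hns ⟨hr, ?_⟩⟩
    rintro _ ⟨j, hj, rfl⟩
    rcases eq_or_lt_of_le (Fin.le_def.1 hj) with h1 | h1
    · rwa [Fin.ext h1]
    · exact hs _ ⟨j, Fin.le_def.2 (Nat.le_of_lt_succ h1), rfl⟩
  · obtain ⟨h, hr, hs⟩ := hnonempty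
    exact ⟨h, hr, fun j _ => hs _ ⟨j, rfl⟩, fun h1 => absurd h1 hi⟩

/-- The length of a chain of solution sets is bounded by the number of hyperplanes covering the
length types of the common solutions of the first two equations. -/
theorem chain_length_le (hn : 2 ≤ n) (hm2 : 2 ≤ m) (E : Fin m → WordEquation n)
    (hnontrivial : ∀ i, ¬ (E i).IsTrivial)
    (hchain : ∀ i j : Fin m, i < j →
      rankSol α (n - 1) (E '' Set.Iic j) ⊂ rankSol α (n - 1) (E '' Set.Iic i))
    (hnonempty : (rankSol α (n - 1) (Set.range E)).Nonempty)
    (κ : Type) [Fintype κ] (V : κ → Submodule ℚ (Fin n → ℚ))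
    (hdim : ∀ k, Module.finrank ℚ (V k) = n - 1)
    (hcover : ∀ h ∈ rankSol α (n - 1) {E ⟨0, by omega⟩, E ⟨1, hm2⟩},
      ∃ k, (fun x => (lengthType h x : ℚ)) ∈ V k) :
    m ≤ Fintype.card κ + 1 := by
  let e₀ : Fin m := ⟨0, by omega⟩
  -- Indices start at 1 because the separating solution must solve both of the first two equations
  -- for the cover to apply. The last index is included through the nonemptiness of the final
  -- solution set, giving `m - 1` indices.
  have key : ∀ i : {i : Fin m // 1 ≤ i.val}, ∃ k,
      (∃ h : FreeMonoid (Fin n) →* FreeMonoid α, morphismRank h = n - 1 ∧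
        (E e₀).IsSolution h ∧ (∀ hi : i.val.val + 1 < m, ¬ (E ⟨i.val.val + 1, hi⟩).IsSolution h) ∧
        (fun x => (lengthType h x : ℚ)) ∈ V k) ∧
      ∀ L : Fin n → ℕ, (fun x => (L x : ℚ)) ∈ V k → ∀ j ≤ i.val, ∃ k : ℕ, k ≠ 0 ∧ ∀ x y,
        (E e₀).row (fun x => (Polynomial.X : Polynomial ℚ) ^ (k * L x)) x *
          (E j).row (fun x => (Polynomial.X : Polynomial ℚ) ^ (k * L x)) y =
        (E e₀).row (fun x => (Polynomial.X : Polynomial ℚ) ^ (k * L x)) y *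
          (E j).row (fun x => (Polynomial.X : Polynomial ℚ) ^ (k * L x)) x := by
    intro i
    obtain ⟨h, hr, hs, hns⟩ := exists_separating_solution E hchain hnonempty i.val
    have hs0 : (E e₀).IsSolution h := hs _ (Fin.le_def.2 (Nat.zero_le _))
    obtain ⟨U, hU, hLU, hminor, hdense⟩ :=
      exists_space_of_rank hn h hr (E e₀) (hnontrivial _) hs0
    obtain ⟨k, hk⟩ := hdense κ V {E e₀, E ⟨1, hm2⟩} (by
      rintro F (rfl | rfl)
      · exact hs0
      · exact hs _ (Fin.le_def.2 i.2)) hcover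
    have hUV : U = V k := Submodule.eq_of_le_of_finrank_eq hk (hU.trans (hdim k).symm)
    subst hUV
    exact ⟨k, ⟨h, hr, hs0, hns, hLU⟩, fun L hL j hj => hminor _ _ hs0 (hs j hj) L hL⟩
  choose k hk1 hk2 using key
  -- If `i < j` shared a hyperplane, the solution separating at `i` would have its length type where
  -- the rows of equations 0 and `i + 1` are proportional, up to scaling, and would solve equation
  -- `i + 1`.
  have hlt : ∀ i j : {i : Fin m // 1 ≤ i.val}, i < j → k i ≠ k j := by
    intro i j hij heq
    obtain ⟨h, hr, hs0, hns, hL⟩ := hk1 i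
    have hij' : i.val.val < j.val.val := hij
    have hi : i.val.val + 1 < m := lt_of_le_of_lt hij' j.val.2
    rw [heq] at hL
    obtain ⟨q, hq, hminor⟩ := hk2 j (lengthType h) hL ⟨_, hi⟩ (Fin.le_def.2 hij')
    exact hns hi (hs0.of_minors_eq (hnontrivial _) hq
      (lengthType_ne_zero_of_rank hn h hr) hminor)
  have hinj : Function.Injective k := by
    intro i j hij
    rcases lt_trichotomy i j with h | h | h
    · exact absurd hij (hlt i j h)
    · exact h
    · exact absurd hij.symm (hlt j i h)
  have hcard : m - 1 ≤ Fintype.card {i : Fin m // 1 ≤ i.val} := by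
    have := Fintype.card_le_of_injective
      (fun i : Fin (m - 1) => (⟨⟨i.val + 1, by omega⟩, by simp⟩ : {i : Fin m // 1 ≤ i.val}))
      (fun i j hij => by simpa [Fin.ext_iff] using hij)
    simpa using this
  have := Fintype.card_le_of_injective k hinj
  omega

end Chain

theorem mainTheorem1 {α : Type*} (n m : ℕ) (hn : 2 ≤ n) (hm : 1 ≤ m)
    (E : Fin m → WordEquation n)
    (hnontrivial : ∀ i, ¬ (E i).IsTrivial)
    (hchain : ∀ i j : Fin m, i < j →
      rankSol α (n - 1) (E '' Set.Iic j) ⊂ rankSol α (n - 1) (E '' Set.Iic i))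
    (hnonempty : (rankSol α (n - 1) (Set.range E)).Nonempty) :
    (∀ (hm2 : 2 ≤ m) (N : ℕ) (V : Fin N → Submodule ℚ (Fin n → ℚ)),
      (∀ k, Module.finrank ℚ (V k) = n - 1) →
      (∀ h ∈ rankSol α (n - 1) {E ⟨0, hm⟩, E ⟨1, hm2⟩},
        ∃ k, (fun x => (lengthType h x : ℚ)) ∈ V k) →
      m ≤ N + 1) ∧
    ∃ x y : Fin n, x ≠ y ∧ m ≤ ((E ⟨0, hm⟩).occ x + (E ⟨0, hm⟩).occ y) ^ 2 + 1 := by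
  refine ⟨fun hm2 N V hdim hcover => ?_, ?_⟩
  · simpa using chain_length_le hn hm2 E hnontrivial hchain hnonempty (Fin N) V hdim hcover
  · by_cases hm2 : 2 ≤ m
    · obtain ⟨h, hr, hs, hns⟩ := exists_separating_solution E hchain hnonempty ⟨0, hm⟩
      have hne := lengthType_ne_zero_of_rank hn h hr
      obtain ⟨x, y, hxy⟩ : ∃ x y,
          (E ⟨0, hm⟩).row (fun x => (Polynomial.X : Polynomial ℚ) ^ lengthType h x) x *
            (E ⟨1, hm2⟩).row (fun x => (Polynomial.X : Polynomial ℚ) ^ lengthType h x) y ≠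
          (E ⟨0, hm⟩).row (fun x => (Polynomial.X : Polynomial ℚ) ^ lengthType h x) y *
            (E ⟨1, hm2⟩).row (fun x => (Polynomial.X : Polynomial ℚ) ^ lengthType h x) x := by
        -- If all minors vanished at the length type of `h`, then `h` would solve the second
        -- equation.
        by_contra! hcon
        exact hns hm2 ((hs _ le_rfl).of_minors_eq (hnontrivial _) one_ne_zero hne
          (by simpa only [one_mul] using hcon))
      obtain ⟨V, hdim, hV⟩ := WordEquation.exists_hyperplanes _ _ x y _ hxy
      refine ⟨x, y, fun heq => hxy (by rw [heq]), ?_⟩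
      have := chain_length_le hn hm2 E hnontrivial hchain hnonempty _ V hdim fun g hg => ?_
      · simpa [sq] using this
      · have h0 : (E ⟨0, hm⟩).IsSolution g := hg.2 _ (by simp)
        have h1 : (E ⟨1, hm2⟩).IsSolution g := hg.2 _ (by simp)
        obtain ⟨U, -, hLU, hminor, -⟩ :=
          exists_space_of_rank hn g hg.1 (E ⟨0, hm⟩) (hnontrivial _) h0
        obtain ⟨q, hq, hq'⟩ := hminor _ _ h0 h1 _ hLU
        obtain ⟨k, hk⟩ := hV (fun x => q * lengthType g x) (hq' x y)
        -- The minor is known to vanish only at `q` times the length type, but subspaces are stable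
        -- under division by `q`.
        refine ⟨k, ((V k).smul_mem_iff (Nat.cast_ne_zero.2 hq : (q : ℚ) ≠ 0)).1 ?_⟩
        convert hk using 1
        funext z
        simp
    · exact ⟨⟨0, by omega⟩, ⟨1, by omega⟩, by simp, by omega⟩
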